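/- Let $n,m\ge 1$. Let $\mathrm{Cor}(n,m)$ be the set of quantum correlators, i.e. of all real $n\times m$ matrices $C=(c_{xy})$ for which there are finite-dimensional complex Hilbert spaces $\mathcal H_A,\mathcal H_B$, a quantum state $\rho$ on $\mathcal H_A\otimes\mathcal H_B$ (a positive semidefinite operator with $\operatorname{tr}\rho=1$), and $\pm1$ observables (Hermitian operators with square the identity) $A_1,\dots,A_n$ on $\mathcal H_A$ and $B_1,\dots,B_m$ on $\mathcal H_B$ such that $c_{xy}=\operatorname{tr}(\rho\,(A_x\otimes B_y))$ for all $x,y$. Let $\mathcal E_{n+m}$ be the elliptope, i.e. the set of real symmetric positive semidefinite $(n+m)\times(n+m)$ matrices with all diagonal entries equal to $1$. A PSD completion of a real $n\times m$ matrix $C$ is a matrix in $\mathcal E_{n+m}$ of the form $\begin{pmatrix}A&C\\ C^{\top}&B\end{pmatrix}$, with $A$ of size $n\times n$ and $B$ of size $m\times m$. **Theorem.** A correlator $C\in\mathrm{Cor}(n,m)$ is an extreme point of $\mathrm{Cor}(n,m)$ if and only if $C$ has a unique PSD completion $\hat C\in\mathcal E_{n+m}$ and, furthermore, $$\operatorname{rank}(\hat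 C\circ\hat C)=\binom{\operatorname{rank}(\hat C)+1}{2},$$ where $\circ$ denotes the entrywise product of matrices. -/

import Mathlib

open scoped Matrix Kronecker ComplexOrder

/-- A `±1` observable on `ℂ^d`: a Hermitian operator all of whose eigenvalues are `±1`,
that is, a Hermitian involution. -/
def IsPMObservable {d : ℕ} (A : Matrix (Fin d) (Fin d) ℂ) : Prop :=
  A.IsHermitian ∧ A * A = 1

/-- A quantum state (density operator) on the space with orthonormal basis indexed by `ι`. -/
def IsQuantumState {ι : Type} [Fintype ι] (ρ : Matrix ι ι ℂ) : Prop :=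
  ρ.PosSemidef ∧ ρ.trace = 1

/-- The set `Cor(n,m)` of quantum correlators: the real matrices `C` with
`C x y = tr (ρ (A x ⊗ B y))` for a quantum state `ρ` on `ℂ^dA ⊗ ℂ^dB` and `±1` observables
`A 1, …, A n` on `ℂ^dA`, `B 1, …, B m` on `ℂ^dB`, with `dA`, `dB` arbitrary. -/
def Cor (n m : ℕ) : Set (Matrix (Fin n) (Fin m) ℝ) :=
  {C | ∃ (dA dB : ℕ) (ρ : Matrix (Fin dA × Fin dB) (Fin dA × Fin dB) ℂ)
      (A : Fin n → Matrix (Fin dA) (Fin dA) ℂ) (B : Fin m → Matrix (Fin dB) (Fin dB) ℂ),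
      IsQuantumState ρ ∧ (∀ x, IsPMObservable (A x)) ∧ (∀ y, IsPMObservable (B y)) ∧
      ∀ x y, (C x y : ℂ) = (ρ * (A x ⊗ₖ B y)).trace}

/-- The elliptope: real positive semidefinite matrices with all diagonal entries equal to `1`. -/
def elliptope (ι : Type) [Fintype ι] : Set (Matrix ι ι ℝ) :=
  {X | X.PosSemidef ∧ ∀ i, X i i = 1}

/-- `X` is a PSD completion of `C`: an element of the elliptope `E_{n+m}` (rows and columns
indexed by the disjoint union of `[n]` and `[m]`) with off-diagonal block `C`. -/
def IsPSDCompletion {n m : ℕ} (C : Matrix (Fin n) (Fin m) ℝ)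
    (X : Matrix (Fin n ⊕ Fin m) (Fin n ⊕ Fin m) ℝ) : Prop :=
  X ∈ elliptope (Fin n ⊕ Fin m) ∧ X.toBlocks₁₂ = C

/-!
By Tsirelson's theorem (`mem_Cor_iff`) a matrix `C` is a quantum correlator iff it has a PSD
completion, that is, iff `C x y = ⟨u x, v y⟩` for real unit vectors. In one direction
`Re tr (ρ S T)` is a Gram form on the observables. In the other, Clifford generators turn vectors
into observables whose correlations on a maximally entangled state are the inner products. So
`Cor n m` is the projection of the elliptope to the off-diagonal block, and the fibre over `C` is
the set of its completions.

An extreme `C` has a single completion. Each `u x` lies in the span of the `v y`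
(`exists_mulVec_eq_of_extreme`): otherwise its projection to that span is shorter than `1`, and
moving the projection both ways along some `v y` writes `C` as a proper midpoint. Hence
every completion has a kernel vector expressing column `x` through the columns `y`. For the
midpoint of two completions such a vector lies in the kernel of both, and it determines their first
diagonal block from `C` (`toBlocks₁₁_eq_of_extreme`); the second block follows by transposition.
Consequently `C` is extreme iff it has a unique completion and that completion is extreme in the
elliptope.

The rank condition is the criterion of Li and Tam for extremality of `X = (⟨wᵢ, wⱼ⟩)` in the
elliptope (`mem_extremePoints_elliptope_iff`), where the `wᵢ` span a space of dimension
`r = rank X`. The admissible perturbations of `X` are `(wᵢᵀ R wⱼ)` with `R` symmetric and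
`wᵢᵀ R wᵢ = 0` for all `i`, so `X` is extreme iff the squares `wᵢ ⊗ wᵢ` span the symmetric tensors,
a space of dimension `(r + 1).choose 2`. Their Gram matrix is the entrywise square of `X`.
-/

/-! ### Gram factorizations of positive semidefinite matrices -/

section Gram

variable {ι κ : Type} [Fintype κ]

theorem Matrix.posSemidef_transpose_mul_self_real [Fintype ι] (W : Matrix κ ι ℝ) :
    (Wᵀ * W).PosSemidef := by
  simpa using Matrix.posSemidef_conjTranspose_mul_self W

theorem Matrix.PosSemidef.transpose_mul_mul_same [Fintype ι] {R : Matrix κ κ ℝ} (hR : R.PosSemidef)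
    (W : Matrix κ ι ℝ) : (Wᵀ * R * W).PosSemidef := by
  simpa using hR.conjTranspose_mul_mul_same W

theorem Matrix.PosSemidef.transpose_eq {X : Matrix ι ι ℝ} (hX : X.PosSemidef) : Xᵀ = X := by
  simpa using hX.1.eq

theorem Matrix.PosSemidef.dotProduct_mulVec_eq_zero_iff [Fintype ι] {X : Matrix ι ι ℝ}
    (hX : X.PosSemidef) (z : ι → ℝ) : z ⬝ᵥ (X *ᵥ z) = 0 ↔ X *ᵥ z = 0 := by
  simpa using hX.dotProduct_mulVec_zero_iff z

/-- A Gram factorization through a space of dimension exactly `rank X`: keep the eigenvectors of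
`X` with nonzero eigenvalue, scaled by the square roots of the eigenvalues. -/
theorem Matrix.PosSemidef.exists_gram [Fintype ι] {X : Matrix ι ι ℝ} (hX : X.PosSemidef) :
    ∃ (κ : Type) (_ : Fintype κ) (W : Matrix κ ι ℝ), Fintype.card κ = X.rank ∧ X = Wᵀ * W := by
  classical
  let ev := hX.1.eigenvalues
  let U : Matrix ι ι ℝ := hX.1.eigenvectorUnitary
  have hspec : X = U * Matrix.diagonal ev * Uᵀ := by
    have := hX.1.spectral_theorem
    rw [Unitary.conjStarAlgAut_apply] at this
    simpa [Matrix.star_eq_conjTranspose] using this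
  refine ⟨{i // ev i ≠ 0}, inferInstance, Matrix.of fun k j => Real.sqrt (ev k) * U j k,
    (hX.1.rank_eq_card_non_zero_eigs).symm, ?_⟩
  ext i j
  have h0 : ∀ k, 0 ≤ ev k := hX.eigenvalues_nonneg
  have h1 : X i j = ∑ k, ev k * (U i k * U j k) := by
    conv_lhs => rw [hspec]
    rw [Matrix.mul_apply]
    simp only [Matrix.mul_diagonal, Matrix.transpose_apply]
    exact Finset.sum_congr rfl fun k _ => by ring
  rw [h1, Matrix.mul_apply]
  simp only [Matrix.transpose_apply, Matrix.of_apply]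
  have h2 : ∀ k, Real.sqrt (ev k) * U i k * (Real.sqrt (ev k) * U j k)
      = ev k * (U i k * U j k) := fun k => by
    linear_combination (U i k * U j k) * Real.mul_self_sqrt (h0 k)
  simp only [h2]
  have h3 : ∑ k with ev k ≠ 0, ev k * (U i k * U j k)
      = ∑ k : {k // ev k ≠ 0}, ev k * (U i k * U j k) :=
    Finset.sum_subtype _ (by simp) _
  rw [Finset.sum_filter] at h3
  exact (Finset.sum_congr rfl fun k _ => by by_cases h : ev k = 0 <;> simp [h]).trans h3

end Gram

/-! ### Extreme points of the elliptope -/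

section LiTam

variable {ι κ : Type} [Fintype κ]

/-- The matrix whose row `i` lists the coordinates of the symmetric square `wᵢ ⊗ wᵢ` of the `i`-th
column of `W`; a monomial `W a i * W b i` is indexed by the unordered pair `s(a, b)`. -/
def symSquare (W : Matrix κ ι ℝ) : Matrix ι (Sym2 κ) ℝ :=
  Matrix.of fun i p => p.lift ⟨fun a b => W a i * W b i, fun _ _ => mul_comm _ _⟩

/-- The Hadamard square of a Gram matrix is the Gram matrix of the tensor squares `wᵢ ⊗ wᵢ`. -/
theorem rank_hadamard_gram [Fintype ι] (W : Matrix κ ι ℝ) :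
    ((Wᵀ * W) ⊙ (Wᵀ * W)).rank = (symSquare W).rank := by
  -- `N` repeats the columns of `symSquare W`: one column for each ordered pair.
  let N : Matrix ι (κ × κ) ℝ := (symSquare W).submatrix id (fun p => s(p.1, p.2))
  have hN : (Wᵀ * W) ⊙ (Wᵀ * W) = N * Nᵀ := by
    ext i j
    simp only [Matrix.hadamard_apply, Matrix.mul_apply, Matrix.transpose_apply,
      Fintype.sum_prod_type, Finset.sum_mul_sum, N, symSquare, Matrix.submatrix_apply,
      Matrix.of_apply, Sym2.lift_mk, id]
    exact Finset.sum_congr rfl fun a _ => Finset.sum_congr rfl fun b _ => by ring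
  have hM : symSquare W = N.submatrix id Quot.out := by
    ext i p
    simp only [N, Matrix.submatrix_apply, id]
    congr 1
    exact (Quot.out_eq p).symm
  rw [hN, Matrix.rank_self_mul_transpose]
  refine le_antisymm (Matrix.rank_submatrix_le _ _ _) ?_
  conv_lhs => rw [hM]
  exact Matrix.rank_submatrix_le _ _ _

theorem Matrix.rank_eq_card_width_iff (M : Matrix ι κ ℝ) :
    M.rank = Fintype.card κ ↔ ∀ q, M *ᵥ q = 0 → q = 0 := by
  have h := LinearMap.finrank_range_add_finrank_ker M.mulVecLin
  rw [Module.finrank_fintype_fun_eq_card] at h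
  have h2 : (∀ q, M *ᵥ q = 0 → q = 0) ↔ LinearMap.ker M.mulVecLin = ⊥ := by
    rw [LinearMap.ker_eq_bot']; rfl
  rw [h2, ← Submodule.finrank_eq_zero (R := ℝ), Matrix.rank]
  omega

theorem diag_transpose_mul_mul_eq_sum_symSquare (W : Matrix κ ι ℝ) (R : Matrix κ κ ℝ) (i : ι) :
    (Wᵀ * R * W) i i = ∑ p : κ × κ, R p.1 p.2 * symSquare W i s(p.1, p.2) := by
  simp only [Matrix.mul_apply, Finset.sum_mul, symSquare, Matrix.of_apply, Sym2.lift_mk,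
    Fintype.sum_prod_type, Matrix.transpose_apply]
  rw [Finset.sum_comm]
  exact Finset.sum_congr rfl fun a _ => Finset.sum_congr rfl fun b _ => by ring

/-- The symmetric squares `wᵢ ⊗ wᵢ` span the symmetric tensors exactly when no nonzero symmetric
`R` is orthogonal to all of them. -/
theorem rank_symSquare_eq_iff (W : Matrix κ ι ℝ) :
    (symSquare W).rank = Fintype.card (Sym2 κ) ↔
      ∀ R : Matrix κ κ ℝ, Rᵀ = R → (∀ i, (Wᵀ * R * W) i i = 0) → R = 0 := by
  classical
  rw [Matrix.rank_eq_card_width_iff]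
  let f : κ × κ → Sym2 κ := fun p => s(p.1, p.2)
  -- The number of ordered pairs over `p` converts sums over `κ × κ` into sums over `Sym2 κ`.
  let c : Sym2 κ → ℝ := fun p => (Finset.univ.filter fun ab => f ab = p).card
  have hc : ∀ p, c p ≠ 0 := by
    intro p
    induction p using Sym2.ind with
    | _ a b =>
      simp only [c, ne_eq, Nat.cast_eq_zero, Finset.card_eq_zero]
      exact Finset.ne_empty_of_mem (a := (a, b)) (by simp [f])
  have key : ∀ (q : Sym2 κ → ℝ) (i : ι),
      ∑ ab : κ × κ, q (f ab) * symSquare W i (f ab) = ∑ p, symSquare W i p * (c p * q p) := by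
    intro q i
    rw [← Finset.sum_fiberwise (s := Finset.univ) (g := f)]
    refine Finset.sum_congr rfl fun p _ => ?_
    rw [Finset.sum_congr rfl (g := fun _ => q p * symSquare W i p)
      (fun x hx => by rw [(Finset.mem_filter.1 hx).2])]
    rw [Finset.sum_const, nsmul_eq_mul]
    simp only [c]; ring
  constructor
  · intro h R hR hz
    let q : Sym2 κ → ℝ := fun p => p.lift ⟨fun a b => R a b, fun a b => congrFun₂ hR b a⟩
    have hq : (fun p => c p * q p) = 0 := by
      apply h
      ext i
      have := hz i
      rw [diag_transpose_mul_mul_eq_sum_symSquare] at this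
      exact (key q i).symm.trans this
    ext a b
    have := congrFun hq s(a, b)
    exact (mul_eq_zero.1 this).resolve_left (hc _)
  · intro h q hq
    let R : Matrix κ κ ℝ := Matrix.of fun a b => q s(a, b) / c s(a, b)
    have hR : R = 0 := by
      refine h R (by ext a b; simp [R, Sym2.eq_swap]) fun i => ?_
      rw [diag_transpose_mul_mul_eq_sum_symSquare]
      refine (key (fun p => q p / c p) i).trans (Eq.trans ?_ (congrFun hq i))
      refine Finset.sum_congr rfl fun p _ => ?_
      rw [mul_div_cancel₀ _ (hc p)]
    ext p
    induction p using Sym2.ind with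
    | _ a b =>
      have := congrFun₂ hR a b
      simpa [R, hc] using this

/-- A real symmetric matrix can be scaled to have norm at most `1`. -/
theorem exists_pos_posSemidef_one_add_smul [DecidableEq κ] {R : Matrix κ κ ℝ} (hR : Rᵀ = R) :
    ∃ ε : ℝ, 0 < ε ∧ (1 + ε • R).PosSemidef ∧ (1 - ε • R).PosSemidef := by
  let S : ℝ := ∑ a, ∑ b, |R a b|
  have hS : 0 ≤ S := Finset.sum_nonneg fun _ _ => Finset.sum_nonneg fun _ _ => abs_nonneg _
  have hsq : ∀ (x : κ → ℝ) a, |x a| * |x a| ≤ x ⬝ᵥ x := fun x a => by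
    rw [abs_mul_abs_self]
    exact Finset.single_le_sum (f := fun a => x a * x a) (fun _ _ => mul_self_nonneg _)
      (Finset.mem_univ a)
  have hb : ∀ x : κ → ℝ, |x ⬝ᵥ (R *ᵥ x)| ≤ S * (x ⬝ᵥ x) := by
    intro x
    have h0 := hsq x
    generalize x ⬝ᵥ x = t at h0 ⊢
    simp only [dotProduct, Matrix.mulVec, S, Finset.sum_mul]
    refine (Finset.abs_sum_le_sum_abs _ _).trans (Finset.sum_le_sum fun a _ => ?_)
    rw [Finset.mul_sum]
    refine (Finset.abs_sum_le_sum_abs _ _).trans (Finset.sum_le_sum fun b _ => ?_)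
    rw [abs_mul, abs_mul]
    have h1 := h0 a
    have h2 := h0 b
    have : |x a| * |x b| ≤ t := by nlinarith [sq_nonneg (|x a| - |x b|)]
    calc |x a| * (|R a b| * |x b|) = |R a b| * (|x a| * |x b|) := by ring
      _ ≤ _ := mul_le_mul_of_nonneg_left this (abs_nonneg _)
  have hx0 : ∀ x : κ → ℝ, 0 ≤ x ⬝ᵥ x := fun x => Finset.sum_nonneg fun _ _ => mul_self_nonneg _
  have hε : 0 < (1 + S)⁻¹ := by positivity
  have hle : ∀ x : κ → ℝ, (1 + S)⁻¹ * |x ⬝ᵥ (R *ᵥ x)| ≤ x ⬝ᵥ x := by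
    intro x
    rw [inv_mul_le_iff₀ (by positivity)]
    nlinarith [hb x, hx0 x]
  refine ⟨(1 + S)⁻¹, hε, .of_dotProduct_mulVec_nonneg ?_ fun x => ?_,
    .of_dotProduct_mulVec_nonneg ?_ fun x => ?_⟩
  · simp [Matrix.IsHermitian, hR]
  · have := hle x
    simp only [star_trivial, Matrix.add_mulVec, Matrix.one_mulVec, Matrix.smul_mulVec,
      dotProduct_add, dotProduct_smul, smul_eq_mul]
    nlinarith [mul_le_mul_of_nonneg_left (neg_abs_le (x ⬝ᵥ (R *ᵥ x))) hε.le]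
  · simp [Matrix.IsHermitian, hR]
  · have := hle x
    simp only [star_trivial, Matrix.sub_mulVec, Matrix.one_mulVec, Matrix.smul_mulVec,
      dotProduct_sub, dotProduct_smul, smul_eq_mul]
    nlinarith [mul_le_mul_of_nonneg_left (le_abs_self (x ⬝ᵥ (R *ᵥ x))) hε.le]

/-- A convex combination of positive semidefinite matrices annihilates only vectors that both
summands annihilate. -/
theorem mulVec_eq_zero_of_openSegment [Fintype ι] {X X₁ X₂ : Matrix ι ι ℝ} (h₁ : X₁.PosSemidef)
    (h₂ : X₂.PosSemidef) (hX : X ∈ openSegment ℝ X₁ X₂) {z : ι → ℝ} (hz : X *ᵥ z = 0) :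
    X₁ *ᵥ z = 0 := by
  obtain ⟨a, b, ha, hb, -, rfl⟩ := hX
  rw [← h₁.dotProduct_mulVec_eq_zero_iff]
  have e : z ⬝ᵥ ((a • X₁ + b • X₂) *ᵥ z) = 0 := by rw [hz, dotProduct_zero]
  simp only [Matrix.add_mulVec, Matrix.smul_mulVec, dotProduct_add, dotProduct_smul,
    smul_eq_mul] at e
  have p1 : 0 ≤ z ⬝ᵥ (X₁ *ᵥ z) := by simpa using h₁.dotProduct_mulVec_nonneg z
  have p2 : 0 ≤ z ⬝ᵥ (X₂ *ᵥ z) := by simpa using h₂.dotProduct_mulVec_nonneg z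
  have h0 : a * (z ⬝ᵥ (X₁ *ᵥ z)) = 0 :=
    ((add_eq_zero_iff_of_nonneg (mul_nonneg ha.le p1) (mul_nonneg hb.le p2)).1 e).1
  exact (mul_eq_zero.1 h0).resolve_left ha.ne'

/-- In a Gram factorization of minimal dimension, the vectors span the space. -/
theorem isUnit_det_mul_transpose_of_card_eq_rank [Fintype ι] [DecidableEq κ] {W : Matrix κ ι ℝ}
    (h : Fintype.card κ = (Wᵀ * W).rank) : IsUnit (W * Wᵀ).det := by
  rw [Matrix.rank_transpose_mul_self, ← Matrix.rank_self_mul_transpose] at h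
  rw [← Matrix.isUnit_iff_isUnit_det, ← Matrix.mulVec_injective_iff_isUnit]
  have := ((W * Wᵀ).rank_eq_card_width_iff).1 h.symm
  exact (injective_iff_map_eq_zero (W * Wᵀ).mulVecLin).2 this

/-- **Li–Tam**: an element `X = (⟨wᵢ, wⱼ⟩)` of the elliptope is extreme iff the squares `wᵢ ⊗ wᵢ`
span the symmetric tensors, a condition that the rank of the Hadamard square detects. -/
theorem mem_extremePoints_elliptope_iff [Fintype ι] {X : Matrix ι ι ℝ} (hX : X ∈ elliptope ι) :
    X ∈ Set.extremePoints ℝ (elliptope ι) ↔ (X ⊙ X).rank = (X.rank + 1).choose 2 := by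
  classical
  obtain ⟨κ, _, W, hκ, hW⟩ := hX.1.exists_gram
  have hu : IsUnit (W * Wᵀ).det :=
    isUnit_det_mul_transpose_of_card_eq_rank (by rw [hκ, ← hW])
  let L : Matrix ι κ ℝ := Wᵀ * (W * Wᵀ)⁻¹
  have hL : W * L = 1 := by
    rw [← Matrix.mul_assoc, Matrix.mul_nonsing_inv _ hu]
  have hL' : Lᵀ * Wᵀ = 1 := by rw [← Matrix.transpose_mul, hL, Matrix.transpose_one]
  rw [← hκ, ← Sym2.card]
  conv_rhs => rw [hW, rank_hadamard_gram, rank_symSquare_eq_iff]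
  constructor
  · intro hext R hR hz
    obtain ⟨ε, hε, hp, hm⟩ := exists_pos_posSemidef_one_add_smul hR
    have e1 : Wᵀ * (1 + ε • R) * W = X + ε • (Wᵀ * R * W) := by
      rw [hW]; simp [Matrix.mul_add, Matrix.add_mul]
    have e2 : Wᵀ * (1 - ε • R) * W = X - ε • (Wᵀ * R * W) := by
      rw [hW]; simp [Matrix.mul_sub, Matrix.sub_mul]
    have m1 : X + ε • (Wᵀ * R * W) ∈ elliptope ι :=
      ⟨e1 ▸ hp.transpose_mul_mul_same W, fun i => by simp [hz i, hX.2 i]⟩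
    have m2 : X - ε • (Wᵀ * R * W) ∈ elliptope ι :=
      ⟨e2 ▸ hm.transpose_mul_mul_same W, fun i => by simp [hz i, hX.2 i]⟩
    have hD := hext.2 m1 m2 ⟨1 / 2, 1 / 2, by norm_num, by norm_num, by norm_num, by
      ext i j; simp; ring⟩
    have hD0 : Wᵀ * R * W = 0 := by
      have : ε • (Wᵀ * R * W) = 0 := by simpa using hD
      exact (smul_eq_zero.1 this).resolve_left hε.ne'
    calc R = Lᵀ * Wᵀ * R * (W * L) := by rw [hL, hL']; simp
      _ = Lᵀ * (Wᵀ * R * W) * L := by simp only [Matrix.mul_assoc]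
      _ = 0 := by rw [hD0]; simp
  · intro h
    refine mem_extremePoints_iff_left.2 ⟨hX, fun X₁ h₁ X₂ h₂ hseg => ?_⟩
    -- `D` vanishes on `ker X = ker W`, hence has the form `Wᵀ R W`.
    let D := X₁ - X
    have hDt : Dᵀ = D := by
      simp only [D, Matrix.transpose_sub, h₁.1.transpose_eq, hX.1.transpose_eq]
    have hDLW : D * (L * W) = D := by
      have h0 : D * (1 - L * W) = 0 := by
        ext i j
        have hXz : X *ᵥ ((1 - L * W).col j) = 0 := by
          have : X * (1 - L * W) = 0 := by
            rw [hW, Matrix.mul_assoc, Matrix.mul_sub, ← Matrix.mul_assoc W, hL]; simp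
          ext i
          exact congrFun₂ this i j
        have := mulVec_eq_zero_of_openSegment h₁.1 h₂.1 hseg hXz
        have hD : D *ᵥ ((1 - L * W).col j) = 0 := by
          rw [Matrix.sub_mulVec, this, hXz, sub_zero]
        exact congrFun hD i
      rw [Matrix.mul_sub, Matrix.mul_one, sub_eq_zero] at h0
      exact h0.symm
    have hD : D = Wᵀ * (Lᵀ * D * L) * W := by
      have h2 := congrArg Matrix.transpose hDLW
      rw [Matrix.transpose_mul, hDt, Matrix.transpose_mul] at h2
      calc D = Wᵀ * Lᵀ * (D * (L * W)) := by rw [hDLW, h2]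
        _ = _ := by simp only [Matrix.mul_assoc]
    have hR := h (Lᵀ * D * L)
      (by simp only [Matrix.transpose_mul, Matrix.transpose_transpose, hDt, Matrix.mul_assoc])
      (fun i => by rw [← hD]; simp [D, h₁.2 i, hX.2 i])
    rw [hR] at hD
    simpa [D, sub_eq_zero] using hD

end LiTam

/-! ### Tsirelson's theorem -/

section Clifford

/-- Real symmetric Clifford generators. Adding one generator doubles the size: the old generators
become `G ⊕ (-G)`, and the new one swaps the two summands. -/
theorem exists_clifford_aux (k : ℕ) :
    ∃ (ι : Type) (_ : Fintype ι) (_ : DecidableEq ι) (_ : Nonempty ι)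
      (G : Fin k → Matrix ι ι ℝ), (∀ a, (G a)ᵀ = G a) ∧
        ∀ a b, G a * G b + G b * G a = if a = b then (2 : ℝ) • 1 else 0 := by
  induction k with
  | zero => exact ⟨Unit, inferInstance, inferInstance, inferInstance, fun _ => 0,
      fun a => a.elim0, fun a => a.elim0⟩
  | succ k ih =>
    obtain ⟨ι, _, _, _, G, hsymm, hG⟩ := ih
    refine ⟨ι ⊕ ι, inferInstance, inferInstance, inferInstance,
      Fin.cons (Matrix.fromBlocks 0 1 1 0) fun a => Matrix.fromBlocks (G a) 0 0 (-G a), ?_, ?_⟩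
    · intro a
      refine Fin.cases ?_ (fun a => ?_) a
      · simp [Matrix.fromBlocks_transpose]
      · simp [Matrix.fromBlocks_transpose, hsymm]
    · intro a b
      refine Fin.cases ?_ (fun a => ?_) a <;> refine Fin.cases ?_ (fun b => ?_) b
      · simp [Matrix.fromBlocks_multiply, Matrix.fromBlocks_add, two_smul, ← Matrix.fromBlocks_one]
      · simp [Matrix.fromBlocks_multiply, Matrix.fromBlocks_add, (Fin.succ_ne_zero _).symm]
      · simp [Matrix.fromBlocks_multiply, Matrix.fromBlocks_add, Fin.succ_ne_zero]
      · simp only [Fin.cons_succ, Matrix.fromBlocks_multiply, Matrix.fromBlocks_add,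
          Matrix.mul_zero, Matrix.zero_mul, add_zero, zero_add, neg_mul_neg, hG, Fin.succ_inj]
        split_ifs
        · rw [← Matrix.fromBlocks_one, Matrix.fromBlocks_smul]; simp
        · simp

theorem exists_clifford (κ : Type) [Fintype κ] [DecidableEq κ] :
    ∃ (d : ℕ) (G : κ → Matrix (Fin d) (Fin d) ℝ), 0 < d ∧ (∀ a, (G a)ᵀ = G a) ∧
        ∀ a b, G a * G b + G b * G a = if a = b then (2 : ℝ) • 1 else 0 := by
  obtain ⟨ι, _, _, _, G, hsymm, hG⟩ := exists_clifford_aux (Fintype.card κ)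
  let e := Fintype.equivFin ι
  let f := Matrix.reindexAlgEquiv ℝ ℝ e
  refine ⟨Fintype.card ι, fun a => f (G (Fintype.equivFin κ a)), Fintype.card_pos, fun a => ?_,
    fun a b => ?_⟩
  · simp [f, Matrix.transpose_submatrix, hsymm]
  · simp only [← map_mul, ← map_add, hG, (Fintype.equivFin κ).injective.eq_iff]
    split_ifs
    · rw [map_smul, map_one]
    · exact map_zero f

variable {κ : Type} [Fintype κ] {d : ℕ}

/-- The Clifford map `w ↦ ∑ wₐ Gₐ`. -/
def cliffordMap (G : κ → Matrix (Fin d) (Fin d) ℝ) (w : κ → ℝ) : Matrix (Fin d) (Fin d) ℝ :=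
  ∑ a, w a • G a

theorem cliffordMap_anticomm [DecidableEq κ] {G : κ → Matrix (Fin d) (Fin d) ℝ}
    (hG : ∀ a b, G a * G b + G b * G a = if a = b then (2 : ℝ) • 1 else 0) (w v : κ → ℝ) :
    cliffordMap G w * cliffordMap G v + cliffordMap G v * cliffordMap G w
      = (2 * (w ⬝ᵥ v)) • 1 := by
  have h1 : cliffordMap G w * cliffordMap G v = ∑ a, ∑ b, (w a * v b) • (G a * G b) := by
    simp only [cliffordMap, Finset.sum_mul_sum, smul_mul_smul_comm]
  have h2 : cliffordMap G v * cliffordMap G w = ∑ a, ∑ b, (w a * v b) • (G b * G a) := by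
    simp only [cliffordMap, Finset.sum_mul_sum, smul_mul_smul_comm]
    rw [Finset.sum_comm]
    exact Finset.sum_congr rfl fun a _ => Finset.sum_congr rfl fun b _ => by rw [mul_comm]
  rw [h1, h2, ← Finset.sum_add_distrib]
  simp only [← Finset.sum_add_distrib, ← smul_add, hG, smul_ite, smul_zero,
    Finset.sum_ite_eq, Finset.mem_univ, if_true]
  rw [dotProduct, Finset.mul_sum, Finset.sum_smul]
  exact Finset.sum_congr rfl fun a _ => by rw [smul_smul, mul_comm]

theorem cliffordMap_mul_self [DecidableEq κ] {G : κ → Matrix (Fin d) (Fin d) ℝ}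
    (hG : ∀ a b, G a * G b + G b * G a = if a = b then (2 : ℝ) • 1 else 0) (w : κ → ℝ) :
    cliffordMap G w * cliffordMap G w = (w ⬝ᵥ w) • 1 := by
  have h := cliffordMap_anticomm hG w w
  rw [← two_smul ℝ, mul_smul] at h
  exact smul_right_injective _ (two_ne_zero (α := ℝ)) h

theorem trace_cliffordMap_mul [DecidableEq κ] {G : κ → Matrix (Fin d) (Fin d) ℝ}
    (hG : ∀ a b, G a * G b + G b * G a = if a = b then (2 : ℝ) • 1 else 0) (w v : κ → ℝ) :
    (cliffordMap G w * cliffordMap G v).trace = d * (w ⬝ᵥ v) := by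
  have h := congrArg Matrix.trace (cliffordMap_anticomm hG w v)
  rw [Matrix.trace_add, Matrix.trace_mul_comm (cliffordMap G v), Matrix.trace_smul,
    Matrix.trace_one, Fintype.card_fin, smul_eq_mul] at h
  linarith

theorem cliffordMap_transpose {G : κ → Matrix (Fin d) (Fin d) ℝ} (hG : ∀ a, (G a)ᵀ = G a)
    (w : κ → ℝ) : (cliffordMap G w)ᵀ = cliffordMap G w := by
  simp [cliffordMap, Matrix.transpose_sum, hG]

theorem isPMObservable_map_ofReal {S : Matrix (Fin d) (Fin d) ℝ} (h : Sᵀ = S) (h1 : S * S = 1) :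
    IsPMObservable (S.map Complex.ofRealHom) := by
  constructor
  · ext i j
    simp [Matrix.conjTranspose_apply, ← congrFun₂ h i j]
  · rw [← Matrix.map_mul, h1]
    simp

end Clifford

section Entangled

/-- The maximally entangled state on `ℂ^d ⊗ ℂ^d`, the projection onto `d^(-1/2) ∑ eᵢ ⊗ eᵢ`. -/
noncomputable def maxEntangled (d : ℕ) : Matrix (Fin d × Fin d) (Fin d × Fin d) ℂ :=
  (d : ℂ)⁻¹ • Matrix.vecMulVec (fun p => if p.1 = p.2 then 1 else 0)
    (star fun p => if p.1 = p.2 then 1 else 0)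

theorem isQuantumState_maxEntangled {d : ℕ} (hd : 0 < d) : IsQuantumState (maxEntangled d) := by
  constructor
  · refine (Matrix.posSemidef_vecMulVec_self_star _).smul ?_
    positivity
  · have : (d : ℂ) ≠ 0 := by exact_mod_cast hd.ne'
    simp [maxEntangled, Matrix.trace, Matrix.vecMulVec_apply, Fintype.sum_prod_type, this]

theorem trace_maxEntangled_mul_kronecker {d : ℕ} (A B : Matrix (Fin d) (Fin d) ℂ) :
    (maxEntangled d * (A ⊗ₖ B)).trace = (d : ℂ)⁻¹ * (A * Bᵀ).trace := by
  rw [maxEntangled, Matrix.smul_mul, Matrix.trace_smul, smul_eq_mul, Matrix.trace_mul_comm]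
  congr 1
  simp [Matrix.trace, Matrix.mul_apply, Matrix.vecMulVec_apply, Fintype.sum_prod_type,
    Matrix.kroneckerMap_apply]

end Entangled

section Tsirelson

variable {n m : ℕ} {C : Matrix (Fin n) (Fin m) ℝ}

/-- Realize Gram vectors by Clifford generators, measured on a maximally entangled state. -/
theorem mem_Cor_of_isPSDCompletion {X : Matrix (Fin n ⊕ Fin m) (Fin n ⊕ Fin m) ℝ}
    (hX : IsPSDCompletion C X) : C ∈ Cor n m := by
  classical
  obtain ⟨κ, _, W, -, hW⟩ := hX.1.1.exists_gram
  obtain ⟨d, G, hd, hsymm, hG⟩ := exists_clifford κ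
  have hXW : ∀ i j, X i j = W.col i ⬝ᵥ W.col j := fun i j => by rw [hW]; rfl
  let S : Fin n ⊕ Fin m → Matrix (Fin d) (Fin d) ℝ := fun i => cliffordMap G (W.col i)
  have hS : ∀ i, IsPMObservable ((S i).map Complex.ofRealHom) := fun i =>
    isPMObservable_map_ofReal (cliffordMap_transpose hsymm _) (by
      rw [cliffordMap_mul_self hG, ← hXW, hX.1.2, one_smul])
  refine ⟨d, d, maxEntangled d, fun x => (S (.inl x)).map Complex.ofRealHom,
    fun y => (S (.inr y)).map Complex.ofRealHom, isQuantumState_maxEntangled hd,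
    fun x => hS _, fun y => hS _, fun x y => ?_⟩
  have hd0 : (d : ℂ) ≠ 0 := by exact_mod_cast hd.ne'
  have htr : (S (.inl x) * S (.inr y)).trace = d * C x y := by
    rw [trace_cliffordMap_mul hG, ← hXW, ← hX.2]; rfl
  have hmap : ∀ M : Matrix (Fin d) (Fin d) ℝ, (M.map Complex.ofRealHom).trace = (M.trace : ℂ) :=
    fun M => by simp [Matrix.trace]
  rw [trace_maxEntangled_mul_kronecker, ← Matrix.transpose_map, cliffordMap_transpose hsymm,
    ← Matrix.map_mul, hmap]
  change _ = _ * (((S (.inl x) * S (.inr y)).trace : ℝ) : ℂ)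
  rw [htr, Complex.ofReal_mul, Complex.ofReal_natCast, inv_mul_cancel_left₀ hd0]

/-- The Gram matrix of the operators `A x ⊗ 1`, `1 ⊗ B y` for the form `(S, T) ↦ Re tr (ρ S T)`
completes the correlator. -/
theorem exists_isPSDCompletion (hC : C ∈ Cor n m) : ∃ X, IsPSDCompletion C X := by
  obtain ⟨dA, dB, ρ, A, B, hρ, hA, hB, h⟩ := hC
  let S : Fin n ⊕ Fin m → Matrix (Fin dA × Fin dB) (Fin dA × Fin dB) ℂ :=
    Sum.elim (fun x => A x ⊗ₖ 1) (fun y => 1 ⊗ₖ B y)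
  have hSh : ∀ i, (S i)ᴴ = S i := by
    rintro (x | y)
    · simp [S, Matrix.conjTranspose_kronecker, (hA x).1.eq]
    · simp [S, Matrix.conjTranspose_kronecker, (hB y).1.eq]
  have hSS : ∀ i, S i * S i = 1 := by
    rintro (x | y)
    · simp [S, ← Matrix.mul_kronecker_mul, (hA x).2]
    · simp [S, ← Matrix.mul_kronecker_mul, (hB y).2]
  refine ⟨Matrix.of fun i j => (ρ * (S i * S j)).trace.re,
    ⟨.of_dotProduct_mulVec_nonneg ?_ fun v => ?_, fun i => ?_⟩, ?_⟩
  · ext i j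
    have : star (ρ * (S j * S i)).trace = (ρ * (S i * S j)).trace := by
      rw [← Matrix.trace_conjTranspose, Matrix.conjTranspose_mul, Matrix.conjTranspose_mul, hSh,
        hSh, hρ.1.1.eq, Matrix.trace_mul_comm]
    simp [Matrix.conjTranspose_apply, ← this]
  · let T : Matrix (Fin dA × Fin dB) (Fin dA × Fin dB) ℂ := ∑ i, (v i : ℂ) • S i
    have hT : Tᴴ = T := by simp [T, Matrix.conjTranspose_sum, hSh]
    have h0 : 0 ≤ (T * ρ * Tᴴ).trace := (hρ.1.mul_mul_conjTranspose_same T).trace_nonneg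
    have h1 : (T * ρ * Tᴴ).trace = ∑ i, ∑ j, (v i : ℂ) * v j * (ρ * (S i * S j)).trace := by
      have hTT : T * T = ∑ i, ∑ j, ((v i : ℂ) * v j) • (S i * S j) := by
        simp only [T, Finset.sum_mul_sum, smul_mul_smul_comm]
      rw [hT, Matrix.trace_mul_comm, ← Matrix.mul_assoc, Matrix.trace_mul_comm, hTT]
      simp only [Finset.mul_sum, Matrix.trace_sum, Matrix.mul_smul, Matrix.trace_smul, smul_eq_mul]
    have h2 := (Complex.le_def.1 h0).1
    rw [h1] at h2
    simp only [Complex.re_sum, ← Complex.ofReal_mul, Complex.re_ofReal_mul, Complex.zero_re] at h2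
    simp only [star_trivial, dotProduct, Matrix.mulVec, Matrix.of_apply, Finset.mul_sum]
    refine h2.trans_eq (Finset.sum_congr rfl fun i _ => Finset.sum_congr rfl fun j _ => by ring)
  · simp [hSS, hρ.2]
  · ext x y
    simp [S, Matrix.toBlocks₁₂, ← Matrix.mul_kronecker_mul, ← h x y]

theorem mem_Cor_iff : C ∈ Cor n m ↔ ∃ X, IsPSDCompletion C X :=
  ⟨exists_isPSDCompletion, fun ⟨_, hX⟩ => mem_Cor_of_isPSDCompletion hX⟩

end Tsirelson

/-! ### Completions of extreme correlators -/

section Extreme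

variable {n m : ℕ} {C : Matrix (Fin n) (Fin m) ℝ}
  {X X₁ X₂ : Matrix (Fin n ⊕ Fin m) (Fin n ⊕ Fin m) ℝ}

/-- Vectors of norm at most one suffice, since their missing length can be added in fresh
orthogonal directions without changing the products `⟨uₓ, v_y⟩`. -/
theorem of_dotProduct_mem_Cor {κ : Type} [Fintype κ] {u : Fin n → κ → ℝ} {v : Fin m → κ → ℝ}
    (hu : ∀ x, u x ⬝ᵥ u x ≤ 1) (hv : ∀ y, v y ⬝ᵥ v y ≤ 1) :
    Matrix.of (fun x y => u x ⬝ᵥ v y) ∈ Cor n m := by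
  classical
  let W : Matrix κ (Fin n ⊕ Fin m) ℝ := Matrix.of fun k i => Sum.elim u v i k
  have hW : ∀ i j, (Wᵀ * W) i j = Sum.elim u v i ⬝ᵥ Sum.elim u v j := fun i j => rfl
  refine mem_Cor_iff.2 ⟨Wᵀ * W + Matrix.diagonal fun i => 1 - (Wᵀ * W) i i,
    ⟨(Matrix.posSemidef_transpose_mul_self_real W).add (.diagonal fun i => ?_), fun i => by simp⟩,
    ?_⟩
  · rw [Pi.zero_apply, sub_nonneg, hW]
    cases i
    · exact hu _
    · exact hv _
  · ext x y
    simp [Matrix.toBlocks₁₂, hW]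

/-- Solvability of the normal equations of least squares. -/
theorem exists_transpose_mul_mulVec_eq {κ μ : Type} [Fintype κ] [Fintype μ] (V : Matrix κ μ ℝ)
    (u : κ → ℝ) : ∃ a, Vᵀ *ᵥ (V *ᵥ a) = Vᵀ *ᵥ u := by
  have hle : LinearMap.range (Vᵀ * V).mulVecLin ≤ LinearMap.range Vᵀ.mulVecLin := by
    rintro _ ⟨a, rfl⟩
    exact ⟨V *ᵥ a, by simp⟩
  have heq := Submodule.eq_of_le_of_finrank_eq hle
    (show (Vᵀ * V).rank = Vᵀ.rank by rw [Matrix.rank_transpose_mul_self, Matrix.rank_transpose])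
  have hmem : Vᵀ *ᵥ u ∈ LinearMap.range (Vᵀ * V).mulVecLin := heq ▸ ⟨u, rfl⟩
  obtain ⟨a, ha⟩ := hmem
  exact ⟨a, by rw [← ha]; exact Matrix.mulVec_mulVec _ _ _⟩

/-- For an extreme correlator `(⟨uₓ, v_y⟩)`, every `uₓ` lies in the span of the `v_y`. Otherwise
the projection of `uₓ` to that span is shorter than `1`, so it can be moved both ways along some
`v_y` without leaving the unit ball. -/
theorem exists_mulVec_eq_of_extreme (hm : 1 ≤ m) {κ : Type} [Fintype κ] {u : Fin n → κ → ℝ}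
    {V : Matrix κ (Fin m) ℝ} (hu : ∀ x, u x ⬝ᵥ u x = 1) (hv : ∀ y, V.col y ⬝ᵥ V.col y = 1)
    (hC : ∀ x y, C x y = u x ⬝ᵥ V.col y) (hext : C ∈ Set.extremePoints ℝ (Cor n m)) (x : Fin n) :
    ∃ a, V *ᵥ a = u x := by
  obtain ⟨a, ha⟩ := exists_transpose_mul_mulVec_eq V (u x)
  refine ⟨a, ?_⟩
  by_contra hne
  set p := V *ᵥ a with hp
  have hpv : ∀ y, p ⬝ᵥ V.col y = u x ⬝ᵥ V.col y := fun y => by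
    rw [dotProduct_comm p, dotProduct_comm (u x)]
    exact congrFun ha y
  have hpp : p ⬝ᵥ p = u x ⬝ᵥ p := by
    have h1 : ∀ w : κ → ℝ, w ⬝ᵥ p = (Vᵀ *ᵥ w) ⬝ᵥ a := fun w => by
      rw [hp, Matrix.dotProduct_mulVec, Matrix.mulVec_transpose]
    rw [h1 p, h1 (u x), ha]
  have hlt : p ⬝ᵥ p < 1 := by
    have h0 : 0 < (u x - p) ⬝ᵥ (u x - p) :=
      (Finset.sum_nonneg fun _ _ => mul_self_nonneg _).lt_of_ne' fun h =>
        hne (sub_eq_zero.1 (dotProduct_self_eq_zero.1 h)).symm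
    rw [sub_dotProduct, dotProduct_sub, dotProduct_sub, hu, dotProduct_comm p (u x)] at h0
    linarith
  let y₀ : Fin m := ⟨0, hm⟩
  -- `ε` is small enough for `p ± ε • v_{y₀}` to stay in the unit ball.
  let c := |p ⬝ᵥ V.col y₀|
  let s := 1 - p ⬝ᵥ p
  have hs : 0 < s := sub_pos.2 hlt
  have hc : 0 ≤ c := abs_nonneg _
  let ε := s / (2 * c + 1 + s)
  have hε : 0 < ε := by positivity
  have hε1 : ε ≤ 1 := (div_le_one (by positivity)).2 (by linarith)
  have hεs : ε * (2 * c + 1 + s) = s := div_mul_cancel₀ _ (by positivity)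
  have hball : ∀ t : ℝ, |t| = ε → (p + t • V.col y₀) ⬝ᵥ (p + t • V.col y₀) ≤ 1 := by
    intro t ht
    have e : (p + t • V.col y₀) ⬝ᵥ (p + t • V.col y₀)
        = p ⬝ᵥ p + 2 * (t * (p ⬝ᵥ V.col y₀)) + t * t := by
      simp only [add_dotProduct, dotProduct_add, smul_dotProduct, dotProduct_smul, smul_eq_mul, hv,
        dotProduct_comm (V.col y₀) p]
      ring
    have h1 : t * (p ⬝ᵥ V.col y₀) ≤ ε * c := by
      refine (le_abs_self _).trans ?_
      rw [abs_mul, ht]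
    have h2 : t * t = ε * ε := by rw [← abs_mul_abs_self, ht]
    rw [e, h2]
    have : p ⬝ᵥ p = 1 - s := by simp [s]
    nlinarith [mul_pos hε hs]
  let U : ℝ → Fin n → κ → ℝ := fun t => Function.update u x (p + t • V.col y₀)
  have hmem : ∀ t : ℝ, |t| = ε → Matrix.of (fun x y => U t x ⬝ᵥ V.col y) ∈ Cor n m := by
    intro t ht
    refine of_dotProduct_mem_Cor (fun x' => ?_) fun y => (hv y).le
    by_cases h : x' = x
    · subst h
      simpa [U] using hball t ht
    · simp [U, h, hu]
  have hval : ∀ t y, U t x ⬝ᵥ V.col y = C x y + t * (V.col y₀ ⬝ᵥ V.col y) := fun t y => by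
    simp [U, add_dotProduct, hpv, hC]
  have heq := hext.2 (hmem ε (abs_of_pos hε)) (hmem (-ε) (by rw [abs_neg, abs_of_pos hε]))
    ⟨1 / 2, 1 / 2, by norm_num, by norm_num, by norm_num, by
      ext x' y
      by_cases h : x' = x
      · subst h
        simp only [Matrix.add_apply, Matrix.smul_apply, Matrix.of_apply, hval, smul_eq_mul]
        ring
      · simp only [Matrix.add_apply, Matrix.smul_apply, Matrix.of_apply, U, smul_eq_mul,
          Function.update_of_ne h, hC]
        ring⟩
  have h1 := congrFun₂ heq x y₀
  rw [Matrix.of_apply, hval, hv] at h1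
  linarith

/-- The relation `uₓ = ∑ a y • v_y` as a kernel vector of the completion; it expresses column `x` of
the completion through the columns `y`. -/
theorem exists_mulVec_eq_zero_of_extreme (hm : 1 ≤ m) (hX : IsPSDCompletion C X)
    (hext : C ∈ Set.extremePoints ℝ (Cor n m)) (x : Fin n) :
    ∃ a : Fin m → ℝ, X *ᵥ Sum.elim (Pi.single x 1) (-a) = 0 := by
  obtain ⟨κ, _, W, -, hW⟩ := hX.1.1.exists_gram
  have hXW : ∀ i j, X i j = W.col i ⬝ᵥ W.col j := fun i j => by rw [hW]; rfl
  let V : Matrix κ (Fin m) ℝ := W.submatrix id Sum.inr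
  obtain ⟨a, ha⟩ := exists_mulVec_eq_of_extreme (u := fun x => W.col (.inl x)) (V := V) hm
    (fun x => by rw [← hXW, hX.1.2]) (fun y => (hXW (.inr y) (.inr y)).symm.trans (hX.1.2 _))
    (fun x y => by rw [← hX.2]; exact hXW _ _) hext x
  refine ⟨a, ?_⟩
  rw [hW, ← Matrix.mulVec_mulVec]
  have : W *ᵥ Sum.elim (Pi.single x 1) (-a) = 0 := by
    ext k
    have := congrFun ha k
    simp only [Matrix.mulVec, dotProduct, V, Matrix.submatrix_apply, id, Matrix.col_apply] at this
    simp [Matrix.mulVec, dotProduct, Pi.single_apply, this]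
  rw [this, Matrix.mulVec_zero]

theorem IsPSDCompletion.of_openSegment {C₁ C₂ : Matrix (Fin n) (Fin m) ℝ}
    (h₁ : IsPSDCompletion C₁ X₁) (h₂ : IsPSDCompletion C₂ X₂) {a b : ℝ} (ha : 0 < a) (hb : 0 < b)
    (hab : a + b = 1) : IsPSDCompletion (a • C₁ + b • C₂) (a • X₁ + b • X₂) := by
  refine ⟨⟨(h₁.1.1.smul ha.le).add (h₂.1.1.smul hb.le), fun i => ?_⟩, ?_⟩
  · simp [h₁.1.2 i, h₂.1.2 i, hab]
  · rw [← h₁.2, ← h₂.2]; rfl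

theorem toBlocks₁₁_eq_of_extreme (hm : 1 ≤ m) (h₁ : IsPSDCompletion C X₁)
    (h₂ : IsPSDCompletion C X₂) (hext : C ∈ Set.extremePoints ℝ (Cor n m)) :
    X₁.toBlocks₁₁ = X₂.toBlocks₁₁ := by
  -- A kernel vector of the midpoint is a common kernel vector of `X₁` and `X₂`.
  let X := (1 / 2 : ℝ) • X₁ + (1 / 2 : ℝ) • X₂
  have hX : IsPSDCompletion C X := by
    have := h₁.of_openSegment h₂ (a := 1 / 2) (b := 1 / 2) (by norm_num) (by norm_num)
      (by norm_num)
    rwa [← add_smul, add_halves, one_smul] at this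
  have hseg : X ∈ openSegment ℝ X₁ X₂ :=
    ⟨1 / 2, 1 / 2, by norm_num, by norm_num, by norm_num, rfl⟩
  have key : ∀ {Y}, IsPSDCompletion C Y → ∀ {a x}, Y *ᵥ Sum.elim (Pi.single x 1) (-a) = 0 →
      ∀ x', Y (.inl x') (.inl x) = ∑ y, C x' y * a y := by
    intro Y hY a x h x'
    have := congrFun h (.inl x')
    have hb : ∀ y, Y (.inl x') (.inr y) = C x' y := fun y => by rw [← hY.2]; rfl
    simp only [Matrix.mulVec, dotProduct, Fintype.sum_sum_type, Sum.elim_inl, Sum.elim_inr,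
      Pi.single_apply, mul_ite, mul_one, mul_zero, Finset.sum_ite_eq', Finset.mem_univ, if_true, hb,
      Pi.neg_apply, mul_neg, Finset.sum_neg_distrib, Pi.zero_apply] at this
    linarith
  ext x' x
  obtain ⟨a, ha⟩ := exists_mulVec_eq_zero_of_extreme hm hX hext x
  have e1 := key h₁ (mulVec_eq_zero_of_openSegment h₁.1.1 h₂.1.1 hseg ha) x'
  have e2 := key h₂ (mulVec_eq_zero_of_openSegment h₂.1.1 h₁.1.1
    (openSegment_symm ℝ X₁ X₂ ▸ hseg) ha) x'
  exact e1.trans e2.symm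

theorem IsPSDCompletion.swap (h : IsPSDCompletion C X) :
    IsPSDCompletion Cᵀ (X.submatrix Sum.swap Sum.swap) := by
  refine ⟨⟨h.1.1.submatrix _, fun i => h.1.2 _⟩, ?_⟩
  ext y x
  rw [← h.2]
  exact congrFun₂ h.1.1.transpose_eq (.inl x) (.inr y)

theorem transpose_mem_Cor (h : C ∈ Cor n m) : Cᵀ ∈ Cor m n := by
  obtain ⟨X, hX⟩ := mem_Cor_iff.1 h
  exact mem_Cor_iff.2 ⟨_, hX.swap⟩

theorem transpose_mem_extremePoints_Cor (h : C ∈ Set.extremePoints ℝ (Cor n m)) :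
    Cᵀ ∈ Set.extremePoints ℝ (Cor m n) := by
  refine mem_extremePoints_iff_left.2 ⟨transpose_mem_Cor h.1, ?_⟩
  rintro C₁ h₁ C₂ h₂ ⟨a, b, ha, hb, hab, e⟩
  have := h.2 (transpose_mem_Cor h₁) (transpose_mem_Cor h₂) ⟨a, b, ha, hb, hab, by
    rw [← Matrix.transpose_smul, ← Matrix.transpose_smul, ← Matrix.transpose_add, e,
      Matrix.transpose_transpose]⟩
  rw [← this, Matrix.transpose_transpose]

theorem isPSDCompletion_unique_of_extreme (hn : 1 ≤ n) (hm : 1 ≤ m) (h₁ : IsPSDCompletion C X₁)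
    (h₂ : IsPSDCompletion C X₂) (hext : C ∈ Set.extremePoints ℝ (Cor n m)) : X₁ = X₂ := by
  have e11 := toBlocks₁₁_eq_of_extreme hm h₁ h₂ hext
  have e22 := toBlocks₁₁_eq_of_extreme hn h₁.swap h₂.swap (transpose_mem_extremePoints_Cor hext)
  have e12 : X₁.toBlocks₁₂ = X₂.toBlocks₁₂ := h₁.2.trans h₂.2.symm
  have e21 : ∀ {Y}, IsPSDCompletion C Y → ∀ y x, Y (.inr y) (.inl x) = C x y := fun hY y x => by
    rw [← hY.2]
    exact congrFun₂ hY.1.1.transpose_eq (.inl x) (.inr y)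
  ext (x | y) (x' | y')
  · exact congrFun₂ e11 x x'
  · exact congrFun₂ e12 x y'
  · rw [e21 h₁, e21 h₂]
  · exact congrFun₂ e22 y y'

theorem mem_extremePoints_elliptope_of_extreme (hn : 1 ≤ n) (hm : 1 ≤ m)
    (hX : IsPSDCompletion C X) (hext : C ∈ Set.extremePoints ℝ (Cor n m)) :
    X ∈ Set.extremePoints ℝ (elliptope (Fin n ⊕ Fin m)) := by
  refine mem_extremePoints_iff_left.2 ⟨hX.1, ?_⟩
  rintro X₁ h₁ X₂ h₂ ⟨a, b, ha, hb, hab, e⟩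
  have hC₁ : X₁.toBlocks₁₂ = C := by
    refine hext.2 (mem_Cor_iff.2 ⟨X₁, h₁, rfl⟩) (mem_Cor_iff.2 ⟨X₂, h₂, rfl⟩)
      ⟨a, b, ha, hb, hab, ?_⟩
    rw [← hX.2, ← e]; rfl
  exact isPSDCompletion_unique_of_extreme hn hm ⟨h₁, hC₁⟩ hX hext

/-- The set of correlators is a projection of the elliptope, so the image of an extreme point is
extreme as soon as its fibre is a single point. -/
theorem mem_extremePoints_Cor_of_unique (hX : IsPSDCompletion C X)
    (huniq : ∀ Y, IsPSDCompletion C Y → Y = X)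
    (hext : X ∈ Set.extremePoints ℝ (elliptope (Fin n ⊕ Fin m))) :
    C ∈ Set.extremePoints ℝ (Cor n m) := by
  refine mem_extremePoints_iff_left.2 ⟨mem_Cor_iff.2 ⟨X, hX⟩, ?_⟩
  rintro C₁ h₁ C₂ h₂ ⟨a, b, ha, hb, hab, rfl⟩
  obtain ⟨X₁, h₁⟩ := mem_Cor_iff.1 h₁
  obtain ⟨X₂, h₂⟩ := mem_Cor_iff.1 h₂
  have e := huniq _ (h₁.of_openSegment h₂ ha hb hab)
  have e₁ : X₁ = X := hext.2 h₁.1 h₂.1 ⟨a, b, ha, hb, hab, e⟩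
  rw [← hX.2, ← e₁, h₁.2]

end Extreme

theorem mainTheorem1 (n m : ℕ) (hn : 1 ≤ n) (hm : 1 ≤ m)
    (C : Matrix (Fin n) (Fin m) ℝ) (hC : C ∈ Cor n m) :
    C ∈ Set.extremePoints ℝ (Cor n m) ↔
      ∃ Chat : Matrix (Fin n ⊕ Fin m) (Fin n ⊕ Fin m) ℝ,
        IsPSDCompletion C Chat ∧ (∀ X, IsPSDCompletion C X → X = Chat) ∧
        (Chat ⊙ Chat).rank = (Chat.rank + 1).choose 2 := by
  constructor
  · intro hext
    obtain ⟨X, hX⟩ := exists_isPSDCompletion hC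
    exact ⟨X, hX, fun Y hY => isPSDCompletion_unique_of_extreme hn hm hY hX hext,
      (mem_extremePoints_elliptope_iff hX.1).1
        (mem_extremePoints_elliptope_of_extreme hn hm hX hext)⟩
  · rintro ⟨X, hX, huniq, hrank⟩
    exact mem_extremePoints_Cor_of_unique hX huniq ((mem_extremePoints_elliptope_iff hX.1).2 hrank)
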